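/- **Corollary (Symplectic unitaries are generic for random tensor networks).** Consider a finite graph with vertices $V$, internal edges $E$ (each with two endpoints in $V$) and $n$ external edges (each attached to one vertex). Fix a physical dimension $a\ge 1$, logical dimensions $d_k\ge 1$ ($k\in V$) and bond dimensions $b_e\ge 1$ ($e\in E$). Let $\mathcal H_k$ be the tensor product of one factor $\mathbb C^a$ for each external edge at $k$, the factor $\mathbb C^{d_k}$, and one factor $\mathbb C^{b_e}$ for each end of an internal edge $e$ at $k$; write $q_k=\dim\mathcal H_k$. Fix unit vectors $|0\rangle_k\in\mathcal H_k$, a unit bulk state vector $|\Phi\rangle\in\bigotimes_k\mathbb C^{d_k}$ and a unit reference vector $|\phi\rangle\in(\mathbb C^a)^{\otimes n}$. For unitaries $U_k$ on $\mathcal H_k$ define the (unnormalized) tensor network state vector $$|\psi\rangle=\langle\Phi|\bigotimes_{e\in E}\langle \mathrm{EPR}_e|\bigotimes_{k\in V}U_k|0\rangle_k\in(\mathbb C^a)^{\otimes n},\qquad |\mathrm{EPR}_e\rangle=\sum_{s=1}^{b_e}|s\,s\rangle ,$$ where $\langle\mathrm{EPR}_e|$ contracts the two legs belonging to the ends of $e$.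 If the $U_k$ are independent random unitaries, the effective dimension $D_{\mathrm{eff}}$ (equilibration value) of the random tensor network is defined by $$\frac1{D_{\mathrm{eff}}}=a^n\,\frac{\mathbb E\big[|\langle\psi|\phi\rangle|^4\big]}{\big(\mathbb E[\langle\psi|\psi\rangle]\big)^2}.$$ For every $k\in V$ let $\Omega_k$ be a symplectic form on $\mathcal H_k$ given by an antisymmetric unitary matrix in the product basis (so $q_k$ is even; for example $\Omega_k=\begin{pmatrix}0&-1\\1&0\end{pmatrix}$ in $q_k/2$-dimensional blocks), and let $\mathrm{Sp}(\Omega_k)=\{U\in U(q_k): U^{T}\Omega_kU=\Omega_k\}$ be the group of symplectic unitaries. Then: 1. Symplectic random states form unitary state $t$-designs for all $t$: for every $k\in V$ and $t\ge 0$, $$\mathbb E_{U\sim\mathrm{Haar}(\mathrm{Sp}(\Omega_k))}\big[U^{\otimes t}(|0\rangle\langle0|_k)^{\otimes t}(U^\dagger)^{\otimes t}\big]=\mathbb E_{U\sim\mathrm{Haar}(U(q_k))}\big[U^{\otimes t}(|0\rangle\langle0|_k)^{\otimes t}(U^\dagger)^{\otimes t}\big].$$ 2. The random tensor network with independent Haar-random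 symplectic unitaries $U_k\in\mathrm{Sp}(\Omega_k)$ has the same effective dimension as the one with independent Haar-random unitaries $U_k\in U(q_k)$, and this common value is positive (and finite): $$D_{\mathrm{eff}}^{\mathrm{Sp}}=D_{\mathrm{eff}}^{U}\in(0,\infty).$$ -/

import Mathlib

open Matrix MeasureTheory
open scoped ComplexConjugate

noncomputable section

/-! ### The compact groups and their Haar probability measures -/

section Groups

variable {ι : Type*} [Fintype ι] [DecidableEq ι]

instance unitaryGroup_measurableSpace : MeasurableSpace (unitaryGroup ι ℂ) := borel _

instance unitaryGroup_borelSpace : BorelSpace (unitaryGroup ι ℂ) := ⟨rfl⟩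

instance unitaryGroup_compactSpace : CompactSpace (unitaryGroup ι ℂ) := by
  refine isCompact_iff_compactSpace.mp (IsCompact.of_isClosed_subset
    (isCompact_univ_pi fun _ : ι => isCompact_univ_pi fun _ : ι =>
      isCompact_closedBall (0 : ℂ) 1) isClosed_unitary ?_)
  intro U hU i _ j _
  simpa using entry_norm_bound_of_unitary hU i j

/-- The symplectic forms compatible with the standard inner product of `ℂ^ι`: antisymmetric and
unitary matrices `Ω`. Up to a change of orthonormal basis, these are the matrices
`[[0, -1], [1, 0]]`; they exist exactly if the dimension is even. -/
structure IsUnitarySymplecticForm (Ω : Matrix ι ι ℂ) : Prop where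
  transpose_eq : Ωᵀ = -Ω
  mem_unitary : Ω ∈ unitaryGroup ι ℂ

/-- The unitary symplectic group: the unitary matrices that preserve `Ω`. -/
def unitarySymplecticGroup (Ω : Matrix ι ι ℂ) : Subgroup (unitaryGroup ι ℂ) where
  carrier := {U | (U : Matrix ι ι ℂ)ᵀ * Ω * (U : Matrix ι ι ℂ) = Ω}
  one_mem' := by simp
  mul_mem' := by
    intro U W hU hW
    have hU' : (U : Matrix ι ι ℂ)ᵀ * Ω * (U : Matrix ι ι ℂ) = Ω := hU
    have hW' : (W : Matrix ι ι ℂ)ᵀ * Ω * (W : Matrix ι ι ℂ) = Ω := hW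
    change ((U : Matrix ι ι ℂ) * (W : Matrix ι ι ℂ))ᵀ * Ω *
      ((U : Matrix ι ι ℂ) * (W : Matrix ι ι ℂ)) = Ω
    rw [Matrix.transpose_mul]
    calc _ = (W : Matrix ι ι ℂ)ᵀ * ((U : Matrix ι ι ℂ)ᵀ * Ω * (U : Matrix ι ι ℂ)) *
          (W : Matrix ι ι ℂ) := by simp only [Matrix.mul_assoc]
      _ = Ω := by rw [hU', hW']
  inv_mem' := by
    intro U hU
    have hU' : (U : Matrix ι ι ℂ)ᵀ * Ω * (U : Matrix ι ι ℂ) = Ω := hU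
    have h : (U : Matrix ι ι ℂ) * ((U⁻¹ : unitaryGroup ι ℂ) : Matrix ι ι ℂ) = 1 :=
      congrArg Subtype.val (mul_inv_cancel U)
    have ht : ((U⁻¹ : unitaryGroup ι ℂ) : Matrix ι ι ℂ)ᵀ * (U : Matrix ι ι ℂ)ᵀ = 1 := by
      rw [← Matrix.transpose_mul, h, Matrix.transpose_one]
    change ((U⁻¹ : unitaryGroup ι ℂ) : Matrix ι ι ℂ)ᵀ * Ω *
      ((U⁻¹ : unitaryGroup ι ℂ) : Matrix ι ι ℂ) = Ω
    calc _ = ((U⁻¹ : unitaryGroup ι ℂ) : Matrix ι ι ℂ)ᵀ *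
          ((U : Matrix ι ι ℂ)ᵀ * Ω * (U : Matrix ι ι ℂ)) *
          ((U⁻¹ : unitaryGroup ι ℂ) : Matrix ι ι ℂ) := by rw [hU']
      _ = (((U⁻¹ : unitaryGroup ι ℂ) : Matrix ι ι ℂ)ᵀ * (U : Matrix ι ι ℂ)ᵀ) * Ω *
          ((U : Matrix ι ι ℂ) * ((U⁻¹ : unitaryGroup ι ℂ) : Matrix ι ι ℂ)) := by
          simp only [Matrix.mul_assoc]
      _ = Ω := by rw [h, ht, Matrix.one_mul, Matrix.mul_one]

instance unitarySymplecticGroup_compactSpace (Ω : Matrix ι ι ℂ) :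
    CompactSpace (unitarySymplecticGroup Ω) := by
  have hc : IsClosed {U : unitaryGroup ι ℂ |
      (U : Matrix ι ι ℂ)ᵀ * Ω * (U : Matrix ι ι ℂ) = Ω} := by
    refine isClosed_eq ?_ continuous_const
    fun_prop
  exact isCompact_iff_compactSpace.mp hc.isCompact

/-- The Haar measure of a compact group, normalized to total mass `1`. -/
def haarProb (G : Type*) [Group G] [TopologicalSpace G] [IsTopologicalGroup G] [CompactSpace G]
    [MeasurableSpace G] [BorelSpace G] : Measure G :=
  Measure.haarMeasure ⊤

/-- The law of a Haar-random unitary matrix. -/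
def haarUnitary (ι : Type*) [Fintype ι] [DecidableEq ι] : Measure (unitaryGroup ι ℂ) :=
  haarProb (unitaryGroup ι ℂ)

/-- The law, among all unitary matrices, of a Haar-random symplectic unitary matrix. -/
def haarSymplectic (Ω : Matrix ι ι ℂ) : Measure (unitaryGroup ι ℂ) :=
  (haarProb (unitarySymplecticGroup Ω)).map Subtype.val

/-- The action of a unitary matrix on a state vector. -/
def applyUnitary (U : unitaryGroup ι ℂ) (v : EuclideanSpace ℂ ι) : EuclideanSpace ℂ ι :=
  WithLp.toLp 2 ((U : Matrix ι ι ℂ) *ᵥ v.ofLp)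

/-- The tensor power `A^{⊗ t}`, acting on `(ℂ^ι)^{⊗ t}` with its product basis. -/
def tensorPower (t : ℕ) (A : Matrix ι ι ℂ) : Matrix (Fin t → ι) (Fin t → ι) ℂ :=
  Matrix.of fun i j => ∏ s, A (i s) (j s)

/-- The `t`-th moment operator `𝔼[U^{⊗ t} (|v⟩⟨v|)^{⊗ t} (U†)^{⊗ t}]`; the expectation is taken
entrywise. -/
def momentOperator (μ : Measure (unitaryGroup ι ℂ)) (v : EuclideanSpace ℂ ι) (t : ℕ) :
    Matrix (Fin t → ι) (Fin t → ι) ℂ :=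
  Matrix.of fun i j => ∫ U : unitaryGroup ι ℂ,
    (tensorPower t (U : Matrix ι ι ℂ) * tensorPower t (vecMulVec v.ofLp (star v.ofLp)) *
      tensorPower t (U : Matrix ι ι ℂ)ᴴ) i j ∂μ

end Groups

/-! ### Random tensor networks -/

/-- A tensor network geometry on a finite graph with vertices `V`, internal edges `E` (an edge `e`
has the two endpoints `ends e 0` and `ends e 1`) and external edges `X` (with one endpoint each),
together with its physical, logical and bond dimensions. -/
structure TensorNetwork (V E X : Type*) where
  ends : E → Fin 2 → V
  site : X → V
  physDim : ℕ
  logDim : V → ℕ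
  bondDim : E → ℕ
  physDim_pos : 0 < physDim
  logDim_pos : ∀ k, 0 < logDim k
  bondDim_pos : ∀ e, 0 < bondDim e

/-- The unnormalized EPR pair `∑ₛ |s s⟩` of bond dimension `b`. -/
def eprPair (b : ℕ) : EuclideanSpace ℂ (Fin b × Fin b) :=
  WithLp.toLp 2 fun p => if p.1 = p.2 then 1 else 0

namespace TensorNetwork

variable {V E X : Type*} [Fintype V] [DecidableEq V] [Fintype E] [DecidableEq E]
  [Fintype X] [DecidableEq X]

/-- The product basis of the space of the tensor at `k`: an index for each external edge at `k`, an
index for the logical leg, and an index for each end of an internal edge at `k`. Its cardinality is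
the total dimension `q_k`. -/
abbrev Leg (N : TensorNetwork V E X) (k : V) : Type _ :=
  ({x : X // N.site x = k} → Fin N.physDim) × Fin (N.logDim k) ×
    ((h : {h : E × Fin 2 // N.ends h.1 h.2 = k}) → Fin (N.bondDim h.1.1))

/-- The bulk Hilbert space. -/
abbrev Bulk (N : TensorNetwork V E X) : Type _ :=
  EuclideanSpace ℂ ((k : V) → Fin (N.logDim k))

/-- The boundary (physical) Hilbert space. -/
abbrev Boundary (N : TensorNetwork V E X) : Type _ :=
  EuclideanSpace ℂ (X → Fin N.physDim)

/-- The tensor network state vector `⟨Φ| ⨂ₑ ⟨EPRₑ| ⨂ₖ |Tₖ⟩`, written in the product basis. -/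
def state (N : TensorNetwork V E X) (Φ : N.Bulk)
    (T : (k : V) → EuclideanSpace ℂ (N.Leg k)) : N.Boundary :=
  WithLp.toLp 2 fun x =>
    ∑ l : (k : V) → Fin (N.logDim k), ∑ s : (h : E × Fin 2) → Fin (N.bondDim h.1),
      conj (Φ l) * (∏ e, conj (eprPair (N.bondDim e) (s (e, 0), s (e, 1)))) *
        ∏ k, T k (fun y => x y.1, l k, fun h => s h.1)

/-- The tensor network state vector whose tensors are `Uₖ |0⟩ₖ`. -/
def randomState (N : TensorNetwork V E X) (Φ : N.Bulk)
    (ref : (k : V) → EuclideanSpace ℂ (N.Leg k))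
    (U : (k : V) → unitaryGroup (N.Leg k) ℂ) : N.Boundary :=
  N.state Φ fun k => applyUnitary (U k) (ref k)

/-- `𝔼[⟨ψ|ψ⟩]`, for `U_k` drawn independently with laws `μ k`. -/
def meanNormSq (N : TensorNetwork V E X) (μ : (k : V) → Measure (unitaryGroup (N.Leg k) ℂ))
    (ref : (k : V) → EuclideanSpace ℂ (N.Leg k)) (Φ : N.Bulk) : ℝ :=
  ∫ U, ‖N.randomState Φ ref U‖ ^ 2 ∂(Measure.pi μ)

/-- `𝔼[|⟨ψ|φ⟩|⁴]`, for `U_k` drawn independently with laws `μ k`. -/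
def meanOverlapPowFour (N : TensorNetwork V E X)
    (μ : (k : V) → Measure (unitaryGroup (N.Leg k) ℂ))
    (ref : (k : V) → EuclideanSpace ℂ (N.Leg k)) (Φ : N.Bulk) (φ : N.Boundary) : ℝ :=
  ∫ U, ‖(inner ℂ (N.randomState Φ ref U) φ : ℂ)‖ ^ 4 ∂(Measure.pi μ)

/-- The inverse effective dimension `1 / D_eff = aⁿ 𝔼[|⟨ψ|φ⟩|⁴] / (𝔼[⟨ψ|ψ⟩])²`. -/
def invEffDim (N : TensorNetwork V E X) (μ : (k : V) → Measure (unitaryGroup (N.Leg k) ℂ))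
    (ref : (k : V) → EuclideanSpace ℂ (N.Leg k)) (Φ : N.Bulk) (φ : N.Boundary) : ℝ :=
  (N.physDim : ℝ) ^ Fintype.card X * N.meanOverlapPowFour μ ref Φ φ / N.meanNormSq μ ref Φ ^ 2

/-- The effective dimension `D_eff`. -/
def effDim (N : TensorNetwork V E X) (μ : (k : V) → Measure (unitaryGroup (N.Leg k) ℂ))
    (ref : (k : V) → EuclideanSpace ℂ (N.Leg k)) (Φ : N.Bulk) (φ : N.Boundary) : ℝ :=
  1 / N.invEffDim μ ref Φ φ

end TensorNetwork

end

/-! Everything rests on one fact: the unitary symplectic group acts transitively on the unit sphere.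
Both Haar measures then push forward to the same law of `U v`, because a compact transitive action
has a unique invariant probability law (`map_applyUnitary_haarSymplectic`). Moment operators and
effective dimensions see `U k` only through the state `U k |0⟩`, so they agree.

Transitivity (`exists_mulVec_eq`) uses the antiunitary `J x = conj (Ω x)`, with `J² = -1`, which
makes the space quaternionic. With frames `A = [v, J v]`, `D = [w, J w]` and `B = A - D`, the
reflection `1 - B (Bᴴ A)⁻¹ Bᴴ` is unitary, commutes with `J` and maps `A` to `D`.

For positivity, the integrands are continuous and nonnegative and Haar measure has full support, so
a single tuple of unitaries with nonzero overlap suffices. Transitivity supplies it by rotating each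
reference vector to a product basis vector. -/

noncomputable section

/-! ### Transitivity on the unit sphere by quaternionic reflections -/

section Transitivity

variable {ι : Type*} [Fintype ι]

/-- The quaternionic frame `[v, J v]` spanned by `v`, where `J x = conj (Ω x)`. -/
def quaternionFrame (Ω : Matrix ι ι ℂ) (v : ι → ℂ) : Matrix ι (Fin 2) ℂ :=
  Matrix.of fun i j => ![v i, star ((Ω *ᵥ v) i)] j

/-- The matrix of the quaternion unit in the frame `[v, J v]`. -/
def quaternionUnit : Matrix (Fin 2) (Fin 2) ℂ := !![0, -1; 1, 0]

theorem quaternionUnit_transpose : quaternionUnitᵀ = -quaternionUnit := by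
  ext i j
  fin_cases i <;> fin_cases j <;> simp [quaternionUnit]

theorem dotProduct_mulVec_self_of_transpose_eq_neg {Ω : Matrix ι ι ℂ} (h : Ωᵀ = -Ω)
    (v : ι → ℂ) : v ⬝ᵥ Ω *ᵥ v = 0 := by
  have h1 : v ⬝ᵥ Ω *ᵥ v = -(v ⬝ᵥ Ω *ᵥ v) := by
    conv_lhs => rw [dotProduct_mulVec, ← mulVec_transpose, h, neg_mulVec, neg_dotProduct,
      dotProduct_comm]
  exact self_eq_neg.mp h1

theorem quaternionFrame_sub (Ω : Matrix ι ι ℂ) (v w : ι → ℂ) :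
    quaternionFrame Ω (v - w) = quaternionFrame Ω v - quaternionFrame Ω w := by
  ext i j
  fin_cases j <;> simp [quaternionFrame, mulVec_sub]

variable [DecidableEq ι]

namespace IsUnitarySymplecticForm

/-- `J` acts on a quaternionic frame by right multiplication with the quaternion unit. -/
theorem mul_quaternionFrame {Ω : Matrix ι ι ℂ} (hΩ : IsUnitarySymplecticForm Ω) (v : ι → ℂ) :
    Ω * quaternionFrame Ω v = (quaternionFrame Ω v)ᴴᵀ * quaternionUnit := by
  -- The complex conjugate of `J² v = -v`.
  have hJ : Ω *ᵥ star (Ω *ᵥ v) = -star v := by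
    have h1 : Ω *ᵥ star (Ω *ᵥ v) = -(Ωᵀ *ᵥ star (Ω *ᵥ v)) := by
      rw [hΩ.transpose_eq, neg_mulVec, neg_neg]
    have h2 : Ωᴴ * Ω = 1 := mem_unitaryGroup_iff'.mp hΩ.mem_unitary
    rw [h1, star_mulVec, mulVec_transpose, vecMul_vecMul, h2, vecMul_one]
  ext i j
  rw [Matrix.mul_apply, Matrix.mul_apply, Fin.sum_univ_two]
  fin_cases j
  · simp [quaternionFrame, quaternionUnit, mulVec, dotProduct]
  · simpa [quaternionFrame, quaternionUnit, mulVec, dotProduct] using congrFun hJ i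

theorem quaternionFrame_transpose_mul {Ω : Matrix ι ι ℂ} (hΩ : IsUnitarySymplecticForm Ω)
    (v : ι → ℂ) :
    (quaternionFrame Ω v)ᵀ * Ω = quaternionUnit * (quaternionFrame Ω v)ᴴ := by
  have h := congrArg transpose (hΩ.mul_quaternionFrame v)
  rw [transpose_mul, transpose_mul, transpose_transpose, hΩ.transpose_eq,
    quaternionUnit_transpose, Matrix.mul_neg, Matrix.neg_mul] at h
  exact neg_injective h

/-- Antisymmetry of `Ω` makes `J v` orthogonal to `v`; unitarity gives it the same length. -/
theorem conjTranspose_quaternionFrame_mul_self {Ω : Matrix ι ι ℂ}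
    (hΩ : IsUnitarySymplecticForm Ω) (v : ι → ℂ) :
    (quaternionFrame Ω v)ᴴ * quaternionFrame Ω v =
      (star v ⬝ᵥ v) • (1 : Matrix (Fin 2) (Fin 2) ℂ) := by
  have h0 := dotProduct_mulVec_self_of_transpose_eq_neg hΩ.transpose_eq v
  have h2 : Ωᴴ * Ω = 1 := mem_unitaryGroup_iff'.mp hΩ.mem_unitary
  have h3 : star (Ω *ᵥ v) ⬝ᵥ Ω *ᵥ v = star v ⬝ᵥ v := by
    rw [star_mulVec, ← dotProduct_mulVec, mulVec_mulVec, h2, one_mulVec]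
  have h4 : star v ⬝ᵥ star (Ω *ᵥ v) = 0 := by
    rw [star_dotProduct_star, dotProduct_comm, h0, star_zero]
  ext i j
  fin_cases i <;> fin_cases j
  · simp [quaternionFrame, Matrix.mul_apply, dotProduct]
  · simpa [quaternionFrame, Matrix.mul_apply, dotProduct] using h4
  · simpa [quaternionFrame, Matrix.mul_apply, dotProduct, mul_comm] using h0
  · simpa [quaternionFrame, Matrix.mul_apply, dotProduct, mul_comm] using h3

open scoped ComplexOrder in
/-- The unitary symplectic group acts transitively on the unit sphere: the quaternionic reflection
along `v - w` maps `v` to `w`. -/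
theorem exists_mulVec_eq {Ω : Matrix ι ι ℂ} (hΩ : IsUnitarySymplecticForm Ω) {v w : ι → ℂ}
    (hv : star v ⬝ᵥ v = 1) (hw : star w ⬝ᵥ w = 1) :
    ∃ S ∈ unitarySymplecticGroup Ω, (S : Matrix ι ι ℂ) *ᵥ v = w := by
  -- The reflection degenerates for `v = w`, where `B = 0`.
  by_cases hvw : v = w
  · exact ⟨1, one_mem _, by simp [hvw]⟩
  have hA := hΩ.conjTranspose_quaternionFrame_mul_self v
  have hD := hΩ.conjTranspose_quaternionFrame_mul_self w
  have hB := hΩ.conjTranspose_quaternionFrame_mul_self (v - w)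
  have hBA := quaternionFrame_sub Ω v w
  have hΩA := hΩ.mul_quaternionFrame v
  have hΩB := hΩ.mul_quaternionFrame (v - w)
  have hBΩ := hΩ.quaternionFrame_transpose_mul (v - w)
  have hA0 : ∀ i, quaternionFrame Ω v i 0 = v i := fun i => rfl
  have hD0 : ∀ i, quaternionFrame Ω w i 0 = w i := fun i => rfl
  have hc : star (v - w) ⬝ᵥ (v - w) ≠ 0 := fun h =>
    hvw (sub_eq_zero.mp (dotProduct_star_self_eq_zero.mp h))
  rw [hv, one_smul] at hA
  rw [hw, one_smul] at hD
  generalize quaternionFrame Ω (v - w) = B at *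
  generalize quaternionFrame Ω v = A at *
  generalize quaternionFrame Ω w = D at *
  generalize star (v - w) ⬝ᵥ (v - w) = c at *
  obtain ⟨M, hM⟩ : ∃ M, M = Bᴴ * A := ⟨_, rfl⟩
  -- Both sides equal `2 - Dᴴ A - Aᴴ D`, since `A` and `D` have orthonormal columns.
  have hMM : M + Mᴴ = Bᴴ * B := by
    rw [hM, hBA]
    simp only [conjTranspose_mul, conjTranspose_sub, conjTranspose_conjTranspose, Matrix.sub_mul,
      Matrix.mul_sub, hA, hD, conjTranspose_one]
    abel
  -- The Hermitian part of `M` is a nonzero multiple of the identity, so `M` has no kernel.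
  have hdet : IsUnit M.det := by
    rw [isUnit_iff_ne_zero]
    intro h
    obtain ⟨x, hx0, hx⟩ := exists_mulVec_eq_zero_iff.mpr h
    have h1 : star x ⬝ᵥ (M + Mᴴ) *ᵥ x = 0 := by
      rw [add_mulVec, dotProduct_add, hx, dotProduct_mulVec, ← star_mulVec, hx]
      simp
    rw [hMM, hB, smul_mulVec, one_mulVec, dotProduct_smul, smul_eq_mul] at h1
    exact hx0 (dotProduct_star_self_eq_zero.mp ((mul_eq_zero.mp h1).resolve_left hc))
  obtain ⟨K, hK⟩ : ∃ K, K = M⁻¹ := ⟨_, rfl⟩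
  have hMK : M * K = 1 := hK ▸ mul_nonsing_inv M hdet
  have hKM : K * M = 1 := hK ▸ nonsing_inv_mul M hdet
  have hKM' : Kᴴ * Mᴴ = 1 := by rw [← conjTranspose_mul, hMK, conjTranspose_one]
  -- `M`, and hence `K`, commutes with the quaternionic structure on the frame coordinates.
  have hJM : quaternionUnit * M = Mᴴᵀ * quaternionUnit := by
    rw [hM, ← Matrix.mul_assoc, ← hBΩ, Matrix.mul_assoc, hΩA, ← Matrix.mul_assoc,
      conjTranspose_mul, transpose_mul, conjTranspose_conjTranspose]
  have hJK : quaternionUnit * K = Kᴴᵀ * quaternionUnit := by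
    have h1 : Kᴴᵀ * Mᴴᵀ = 1 := by
      rw [← transpose_mul, ← conjTranspose_mul, hKM, conjTranspose_one, transpose_one]
    calc quaternionUnit * K = Kᴴᵀ * Mᴴᵀ * quaternionUnit * K := by rw [h1, Matrix.one_mul]
      _ = Kᴴᵀ * (Mᴴᵀ * quaternionUnit) * K := by simp only [Matrix.mul_assoc]
      _ = Kᴴᵀ * quaternionUnit * (M * K) := by rw [← hJM]; simp only [Matrix.mul_assoc]
      _ = Kᴴᵀ * quaternionUnit := by rw [hMK, Matrix.mul_one]
  have hunit : (1 - B * K * Bᴴ)ᴴ * (1 - B * K * Bᴴ) = 1 := by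
    -- This makes the quadratic term of `Sᴴ S` cancel the linear ones.
    have h1 : Kᴴ * (Bᴴ * B) * K = Kᴴ + K := by
      rw [← hMM, Matrix.mul_add, Matrix.add_mul, hKM', Matrix.mul_assoc, hMK, Matrix.mul_one,
        Matrix.one_mul]
    have h2 : B * Kᴴ * Bᴴ * (B * K * Bᴴ) = B * Kᴴ * Bᴴ + B * K * Bᴴ := by
      calc _ = B * (Kᴴ * (Bᴴ * B) * K) * Bᴴ := by simp only [Matrix.mul_assoc]
        _ = _ := by rw [h1, Matrix.mul_add, Matrix.add_mul]
    have h3 : (1 - B * K * Bᴴ)ᴴ = 1 - B * Kᴴ * Bᴴ := by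
      simp [conjTranspose_mul, Matrix.mul_assoc]
    rw [h3, Matrix.sub_mul, Matrix.one_mul, Matrix.mul_sub, Matrix.mul_one, h2]
    abel
  -- The reflection commutes with `J`; for a unitary matrix this amounts to preserving `Ω`.
  have hsymp : Ω * (1 - B * K * Bᴴ) = (1 - B * K * Bᴴ)ᴴᵀ * Ω := by
    have h1 : (1 - B * K * Bᴴ)ᴴᵀ = 1 - Bᴴᵀ * Kᴴᵀ * Bᵀ := by
      simp [conjTranspose_mul, transpose_mul, Matrix.mul_assoc]
    have h2 : Ω * (B * K * Bᴴ) = Bᴴᵀ * Kᴴᵀ * Bᵀ * Ω := by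
      calc Ω * (B * K * Bᴴ) = Ω * B * K * Bᴴ := by simp only [Matrix.mul_assoc]
        _ = Bᴴᵀ * (quaternionUnit * K) * Bᴴ := by rw [hΩB]; simp only [Matrix.mul_assoc]
        _ = Bᴴᵀ * Kᴴᵀ * (quaternionUnit * Bᴴ) := by rw [hJK]; simp only [Matrix.mul_assoc]
        _ = Bᴴᵀ * Kᴴᵀ * Bᵀ * Ω := by rw [← hBΩ]; simp only [Matrix.mul_assoc]
    rw [h1, Matrix.mul_sub, Matrix.sub_mul, h2, Matrix.mul_one, Matrix.one_mul]
  have hSA : (1 - B * K * Bᴴ) * A = D := by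
    rw [Matrix.sub_mul, Matrix.one_mul, Matrix.mul_assoc, ← hM, Matrix.mul_assoc, hKM,
      Matrix.mul_one, hBA, sub_sub_cancel]
  generalize 1 - B * K * Bᴴ = S at *
  refine ⟨⟨S, mem_unitaryGroup_iff'.mpr hunit⟩, ?_, ?_⟩
  · change Sᵀ * Ω * S = Ω
    have h1 : Sᵀ * Sᴴᵀ = 1 := by rw [← transpose_mul, hunit, transpose_one]
    rw [Matrix.mul_assoc, hsymp, ← Matrix.mul_assoc, h1, Matrix.one_mul]
  · ext i
    rw [← hD0, ← hSA, Matrix.mul_apply]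
    simp [mulVec, dotProduct, hA0]

end IsUnitarySymplecticForm

end Transitivity
end

noncomputable section

/-! ### Invariance of Haar probability measures -/

section HaarProb

variable (G : Type*) [Group G] [TopologicalSpace G] [IsTopologicalGroup G] [CompactSpace G]
    [MeasurableSpace G] [BorelSpace G]

instance haarProb_isHaarMeasure : (haarProb G).IsHaarMeasure :=
  Measure.isHaarMeasure_haarMeasure _

instance haarProb_isProbabilityMeasure : IsProbabilityMeasure (haarProb G) :=
  ⟨Measure.haarMeasure_self (K₀ := ⊤)⟩

/-- A right translate is again a Haar probability measure, hence the same one by uniqueness. -/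
instance haarProb_isMulRightInvariant : (haarProb G).IsMulRightInvariant := by
  refine ⟨fun g => ?_⟩
  have : IsProbabilityMeasure ((haarProb G).map (· * g)) :=
    Measure.isProbabilityMeasure_map (measurable_mul_const g).aemeasurable
  exact Measure.isHaarMeasure_eq_of_isProbabilityMeasure _ _

end HaarProb

/-! ### The law of a random state and its moments -/

section SphereLaw

variable {ι : Type*} [Fintype ι] [DecidableEq ι]

instance unitaryGroup_secondCountableTopology :
    SecondCountableTopology (unitaryGroup ι ℂ) :=
  have : SecondCountableTopology (Matrix ι ι ℂ) :=
    inferInstanceAs (SecondCountableTopology (ι → ι → ℂ))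
  TopologicalSpace.Subtype.secondCountableTopology (unitaryGroup ι ℂ : Set (Matrix ι ι ℂ))

instance haarUnitary_isProbabilityMeasure : IsProbabilityMeasure (haarUnitary ι) :=
  haarProb_isProbabilityMeasure _

instance haarUnitary_isHaarMeasure : (haarUnitary ι).IsHaarMeasure :=
  haarProb_isHaarMeasure _

instance haarSymplectic_isProbabilityMeasure (Ω : Matrix ι ι ℂ) :
    IsProbabilityMeasure (haarSymplectic Ω) :=
  Measure.isProbabilityMeasure_map measurable_subtype_coe.aemeasurable

theorem continuous_applyUnitary (v : EuclideanSpace ℂ ι) :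
    Continuous fun U : unitaryGroup ι ℂ => applyUnitary U v := by
  unfold applyUnitary
  fun_prop

theorem applyUnitary_mul (U W : unitaryGroup ι ℂ) (v : EuclideanSpace ℂ ι) :
    applyUnitary (U * W) v = applyUnitary U (applyUnitary W v) := by
  simp [applyUnitary]

omit [DecidableEq ι] in
theorem star_dotProduct_self_eq_one {v : EuclideanSpace ℂ ι} (hv : ‖v‖ = 1) :
    star v.ofLp ⬝ᵥ v.ofLp = 1 := by
  rw [dotProduct_comm, ← EuclideanSpace.inner_eq_star_dotProduct, inner_self_eq_norm_sq_to_K, hv]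
  simp

theorem norm_applyUnitary (U : unitaryGroup ι ℂ) (v : EuclideanSpace ℂ ι) :
    ‖applyUnitary U v‖ = ‖v‖ := by
  have h2 : (U : Matrix ι ι ℂ)ᴴ * U = 1 := mem_unitaryGroup_iff'.mp U.2
  have h : inner ℂ (applyUnitary U v) (applyUnitary U v) = inner ℂ v v := by
    rw [EuclideanSpace.inner_eq_star_dotProduct, EuclideanSpace.inner_eq_star_dotProduct,
      dotProduct_comm, dotProduct_comm v.ofLp]
    simp only [applyUnitary]
    rw [star_mulVec, ← dotProduct_mulVec, mulVec_mulVec, h2, one_mulVec]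
  rw [inner_self_eq_norm_sq_to_K, inner_self_eq_norm_sq_to_K] at h
  have h' : ‖applyUnitary U v‖ ^ 2 = ‖v‖ ^ 2 := by exact_mod_cast h
  exact (pow_left_inj₀ (norm_nonneg _) (norm_nonneg _) two_ne_zero).mp h'

namespace IsUnitarySymplecticForm

variable {Ω : Matrix ι ι ℂ}

theorem exists_applyUnitary_eq (hΩ : IsUnitarySymplecticForm Ω) {v w : EuclideanSpace ℂ ι}
    (hv : ‖v‖ = 1) (hw : ‖w‖ = 1) : ∃ S : unitarySymplecticGroup Ω, applyUnitary S v = w := by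
  obtain ⟨S, hS, h⟩ := hΩ.exists_mulVec_eq (star_dotProduct_self_eq_one hv)
    (star_dotProduct_self_eq_one hw)
  exact ⟨⟨S, hS⟩, by simp [applyUnitary, h]⟩

/-- A Haar-random symplectic state has the same law as a Haar-random state. -/
theorem map_applyUnitary_haarSymplectic (hΩ : IsUnitarySymplecticForm Ω)
    {v : EuclideanSpace ℂ ι} (hv : ‖v‖ = 1) :
    (haarSymplectic Ω).map (fun U => applyUnitary U v) =
      (haarUnitary ι).map (fun U => applyUnitary U v) := by
  have hm (w : EuclideanSpace ℂ ι) :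
      Measurable fun U : unitaryGroup ι ℂ => applyUnitary U w :=
    (continuous_applyUnitary w).measurable
  refine Measure.ext_of_lintegral _ fun f hf => ?_
  rw [lintegral_map hf (hm v), lintegral_map hf (hm v), haarSymplectic,
    lintegral_map (f := fun U => f (applyUnitary U v)) (hf.comp (hm v)) measurable_subtype_coe]
  -- By transitivity `U v = T v` with `T` symplectic, and right invariance absorbs `T`.
  have hinv (U : unitaryGroup ι ℂ) :
      ∫⁻ S : unitarySymplecticGroup Ω, f (applyUnitary (S * U) v)
          ∂haarProb (unitarySymplecticGroup Ω) =
        ∫⁻ S : unitarySymplecticGroup Ω, f (applyUnitary S v)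
          ∂haarProb (unitarySymplecticGroup Ω) := by
    obtain ⟨T, hT⟩ := hΩ.exists_applyUnitary_eq hv ((norm_applyUnitary U v).trans hv)
    rw [← lintegral_mul_right_eq_self (fun S : unitarySymplecticGroup Ω =>
      f (applyUnitary S v)) T]
    simp only [Subgroup.coe_mul, applyUnitary_mul, hT]
  have hmeas : Measurable fun p : unitaryGroup ι ℂ × unitarySymplecticGroup Ω =>
      f (applyUnitary (p.2 * p.1) v) :=
    hf.comp ((hm v).comp ((measurable_subtype_coe.comp measurable_snd).mul measurable_fst))
  -- The average of `f (S U v)` over both groups is computed in two orders: integrating over `S`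
  -- first removes `U`, integrating over `U` first removes `S`.
  calc _ = ∫⁻ _ : unitaryGroup ι ℂ, ∫⁻ S : unitarySymplecticGroup Ω, f (applyUnitary S v)
          ∂haarProb (unitarySymplecticGroup Ω) ∂haarUnitary ι := by simp
    _ = ∫⁻ U : unitaryGroup ι ℂ, ∫⁻ S : unitarySymplecticGroup Ω, f (applyUnitary (S * U) v)
          ∂haarProb (unitarySymplecticGroup Ω) ∂haarUnitary ι := by simp only [hinv]
    _ = ∫⁻ S : unitarySymplecticGroup Ω, ∫⁻ U : unitaryGroup ι ℂ, f (applyUnitary (S * U) v)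
          ∂haarUnitary ι ∂haarProb (unitarySymplecticGroup Ω) :=
        lintegral_lintegral_swap hmeas.aemeasurable
    _ = ∫⁻ _ : unitarySymplecticGroup Ω, ∫⁻ U : unitaryGroup ι ℂ, f (applyUnitary U v)
          ∂haarUnitary ι ∂haarProb (unitarySymplecticGroup Ω) := by
        refine lintegral_congr fun S => ?_
        exact lintegral_mul_left_eq_self (fun U => f (applyUnitary U v)) (S : unitaryGroup ι ℂ)
    _ = _ := by simp

end IsUnitarySymplecticForm

/-- The moment operator of a random unitary depends only on the law of the random state. -/
theorem momentOperator_congr {μ ν : Measure (unitaryGroup ι ℂ)} {v : EuclideanSpace ℂ ι}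
    (h : μ.map (fun U => applyUnitary U v) = ν.map (fun U => applyUnitary U v)) (t : ℕ) :
    momentOperator μ v t = momentOperator ν v t := by
  -- The conjugated operator is the tensor power of the rank-one projector on `U v`.
  have key (U : unitaryGroup ι ℂ) (i j : Fin t → ι) :
      (tensorPower t (U : Matrix ι ι ℂ) * tensorPower t (vecMulVec v.ofLp (star v.ofLp)) *
        tensorPower t (U : Matrix ι ι ℂ)ᴴ) i j =
      ∏ s, applyUnitary U v (i s) * conj (applyUnitary U v (j s)) := by
    have hmul (A B : Matrix ι ι ℂ) : tensorPower t A * tensorPower t B = tensorPower t (A * B) := by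
      ext i j
      simp only [tensorPower, Matrix.mul_apply, of_apply, ← Finset.prod_mul_distrib]
      exact (Fintype.prod_sum fun s a => A (i s) a * B a (j s)).symm
    rw [hmul, hmul, mul_vecMulVec, vecMulVec_mul, ← star_mulVec]
    simp [tensorPower, applyUnitary, vecMulVec_apply]
  have hm := (continuous_applyUnitary v).measurable
  ext i j
  simp only [momentOperator, of_apply, key]
  have hg : Continuous fun w : EuclideanSpace ℂ ι => ∏ s, w (i s) * conj (w (j s)) := by
    fun_prop
  have e (ρ : Measure (unitaryGroup ι ℂ)) := integral_map (μ := ρ) hm.aemeasurable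
    (hg.aestronglyMeasurable (μ := ρ.map _))
  rw [← e μ, ← e ν, h]

end SphereLaw
end

noncomputable section

/-! ### Tensor network averages as functions of the tensor laws -/

namespace TensorNetwork

variable {V E X : Type*} [Fintype V] [DecidableEq V] [Fintype E] [DecidableEq E]
  [Fintype X] [DecidableEq X] (N : TensorNetwork V E X)

omit [Fintype X] [DecidableEq X] in
theorem continuous_state (Φ : N.Bulk) : Continuous (N.state Φ) := by
  unfold state
  fun_prop

theorem continuous_randomState (Φ : N.Bulk) (ref : (k : V) → EuclideanSpace ℂ (N.Leg k)) :
    Continuous (N.randomState Φ ref) :=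
  (N.continuous_state Φ).comp
    (continuous_pi fun k => (continuous_applyUnitary (ref k)).comp (continuous_apply k))

/-- Expectations over a random tensor network depend only on the laws of the random tensors. -/
theorem integral_randomState_congr (Φ : N.Bulk) (ref : (k : V) → EuclideanSpace ℂ (N.Leg k))
    {μ ν : (k : V) → Measure (unitaryGroup (N.Leg k) ℂ)}
    [∀ k, IsProbabilityMeasure (μ k)] [∀ k, IsProbabilityMeasure (ν k)]
    (h : ∀ k, (μ k).map (fun U => applyUnitary U (ref k)) =
      (ν k).map (fun U => applyUnitary U (ref k)))
    {f : N.Boundary → ℝ} (hf : Continuous f) :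
    ∫ U, f (N.randomState Φ ref U) ∂Measure.pi μ =
      ∫ U, f (N.randomState Φ ref U) ∂Measure.pi ν := by
  have hm (k : V) : Measurable fun U : unitaryGroup (N.Leg k) ℂ => applyUnitary U (ref k) :=
    (continuous_applyUnitary (ref k)).measurable
  have e (ρ : (k : V) → Measure (unitaryGroup (N.Leg k) ℂ)) [∀ k, IsProbabilityMeasure (ρ k)] :
      ∫ U, f (N.randomState Φ ref U) ∂Measure.pi ρ =
        ∫ T, f (N.state Φ T)
          ∂Measure.pi fun k => (ρ k).map (fun U => applyUnitary U (ref k)) := by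
    have (k : V) : IsProbabilityMeasure ((ρ k).map (fun U => applyUnitary U (ref k))) :=
      Measure.isProbabilityMeasure_map (hm k).aemeasurable
    rw [← Measure.pi_map_pi fun k => (hm k).aemeasurable]
    have hs : Continuous fun T => f (N.state Φ T) := hf.comp (N.continuous_state Φ)
    exact (integral_map (measurable_pi_lambda _ fun k =>
      (hm k).comp (measurable_pi_apply k)).aemeasurable hs.aestronglyMeasurable).symm
  rw [e μ, e ν]
  simp only [h]

theorem effDim_congr (Φ : N.Bulk) (φ : N.Boundary) (ref : (k : V) → EuclideanSpace ℂ (N.Leg k))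
    {μ ν : (k : V) → Measure (unitaryGroup (N.Leg k) ℂ)}
    [∀ k, IsProbabilityMeasure (μ k)] [∀ k, IsProbabilityMeasure (ν k)]
    (h : ∀ k, (μ k).map (fun U => applyUnitary U (ref k)) =
      (ν k).map (fun U => applyUnitary U (ref k))) :
    N.effDim μ ref Φ φ = N.effDim ν ref Φ φ := by
  have h1 : N.meanNormSq μ ref Φ = N.meanNormSq ν ref Φ :=
    N.integral_randomState_congr Φ ref h (f := fun ψ => ‖ψ‖ ^ 2) (by fun_prop)
  have h2 : N.meanOverlapPowFour μ ref Φ φ = N.meanOverlapPowFour ν ref Φ φ :=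
    N.integral_randomState_congr Φ ref h (f := fun ψ => ‖(inner ℂ ψ φ : ℂ)‖ ^ 4) (by fun_prop)
  rw [effDim, effDim, invEffDim, invEffDim, h1, h2]

/-! ### Positivity of the effective dimension -/

/-- The basis tensors that project the legs onto the boundary configuration `x`, the bulk
configuration `l` and the bond configuration `s`. -/
def basisTensor (x : X → Fin N.physDim) (l : (k : V) → Fin (N.logDim k))
    (s : (h : E × Fin 2) → Fin (N.bondDim h.1)) (k : V) : EuclideanSpace ℂ (N.Leg k) :=
  EuclideanSpace.single (fun y => x y.1, l k, fun h => s h.1) 1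

omit [DecidableEq E] [DecidableEq X] in
-- Every leg sits at some vertex, so agreement at all vertices is global agreement.
theorem prod_basisTensor (x x' : X → Fin N.physDim) (l l' : (k : V) → Fin (N.logDim k))
    (s s' : (h : E × Fin 2) → Fin (N.bondDim h.1)) :
    ∏ k, N.basisTensor x l s k (fun y => x' y.1, l' k, fun h => s' h.1) =
      if x' = x ∧ l' = l ∧ s' = s then 1 else 0 := by
  split_ifs with h
  · obtain ⟨rfl, rfl, rfl⟩ := h
    simp [basisTensor]
  · contrapose! h
    rw [Finset.prod_ne_zero_iff] at h
    have hk (k : V) := h k (Finset.mem_univ k)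
    simp only [basisTensor, PiLp.single_apply, ne_eq, ite_eq_right_iff, one_ne_zero,
      imp_false, not_not, Prod.mk.injEq] at hk
    refine ⟨?_, ?_, ?_⟩
    · funext y
      exact congrFun (hk (N.site y)).1 ⟨y, rfl⟩
    · funext k
      exact (hk k).2.1
    · funext e
      exact congrFun (hk (N.ends e.1 e.2)).2.2 ⟨e, rfl⟩

omit [DecidableEq X] in
theorem state_basisTensor (Φ : N.Bulk) (x : X → Fin N.physDim)
    (l : (k : V) → Fin (N.logDim k)) (s : (h : E × Fin 2) → Fin (N.bondDim h.1)) :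
    N.state Φ (N.basisTensor x l s) = EuclideanSpace.single x
      (conj (Φ l) * ∏ e, conj (eprPair (N.bondDim e) (s (e, 0), s (e, 1)))) := by
  ext x'
  simp only [state, prod_basisTensor]
  rw [Finset.sum_eq_single l, Finset.sum_eq_single s]
  · simp
  · intro s' _ hs
    simp [hs]
  · simp
  · intro l' _ hl
    simp [hl]
  · simp

/-- Some choice of unitaries gives a tensor network state with nonzero overlap. -/
theorem exists_inner_randomState_ne_zero {Ω : (k : V) → Matrix (N.Leg k) (N.Leg k) ℂ}
    (hΩ : ∀ k, IsUnitarySymplecticForm (Ω k)) {ref : (k : V) → EuclideanSpace ℂ (N.Leg k)}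
    (href : ∀ k, ‖ref k‖ = 1) {Φ : N.Bulk} (hΦ : Φ ≠ 0) {φ : N.Boundary} (hφ : φ ≠ 0) :
    ∃ U, (inner ℂ (N.randomState Φ ref U) φ : ℂ) ≠ 0 := by
  obtain ⟨l, hl⟩ : ∃ l, Φ l ≠ 0 := by
    contrapose! hΦ
    ext l
    exact hΦ l
  obtain ⟨x, hx⟩ : ∃ x, φ x ≠ 0 := by
    contrapose! hφ
    ext x
    exact hφ x
  -- Equal indices at the two ends of each edge give every EPR factor the value `1`.
  let s : (h : E × Fin 2) → Fin (N.bondDim h.1) := fun h => ⟨0, N.bondDim_pos h.1⟩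
  choose S hS using fun k => (hΩ k).exists_applyUnitary_eq (href k)
    (w := N.basisTensor x l s k) (by simp [basisTensor])
  refine ⟨fun k => S k, ?_⟩
  simp only [randomState, hS]
  change inner ℂ (N.state Φ (N.basisTensor x l s)) φ ≠ 0
  rw [state_basisTensor, EuclideanSpace.inner_single_left]
  simp [eprPair, s, hl, hx]

theorem integral_randomState_pos {μ : (k : V) → Measure (unitaryGroup (N.Leg k) ℂ)}
    [∀ k, IsProbabilityMeasure (μ k)] [∀ k, (μ k).IsOpenPosMeasure] {Φ : N.Bulk}
    {ref : (k : V) → EuclideanSpace ℂ (N.Leg k)} {f : N.Boundary → ℝ} (hf : Continuous f)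
    (hf0 : ∀ ψ, 0 ≤ f ψ) {U : (k : V) → unitaryGroup (N.Leg k) ℂ}
    (hU : f (N.randomState Φ ref U) ≠ 0) :
    0 < ∫ U, f (N.randomState Φ ref U) ∂Measure.pi μ :=
  (hf.comp (N.continuous_randomState Φ ref)).integral_pos_of_hasCompactSupport_nonneg_nonzero
    (HasCompactSupport.of_compactSpace _) (fun _ => hf0 _) hU

/-- As `1 / 0 = 0` in `ℝ`, positivity also encodes finiteness: neither mean can vanish. -/
theorem effDim_pos {μ : (k : V) → Measure (unitaryGroup (N.Leg k) ℂ)}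
    [∀ k, IsProbabilityMeasure (μ k)] [∀ k, (μ k).IsOpenPosMeasure]
    {Ω : (k : V) → Matrix (N.Leg k) (N.Leg k) ℂ}
    (hΩ : ∀ k, IsUnitarySymplecticForm (Ω k)) {ref : (k : V) → EuclideanSpace ℂ (N.Leg k)}
    (href : ∀ k, ‖ref k‖ = 1) {Φ : N.Bulk} (hΦ : Φ ≠ 0) {φ : N.Boundary} (hφ : φ ≠ 0) :
    0 < N.effDim μ ref Φ φ := by
  obtain ⟨U, hU⟩ := N.exists_inner_randomState_ne_zero hΩ href hΦ hφ
  have h1 : 0 < N.meanNormSq μ ref Φ := by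
    refine N.integral_randomState_pos (f := fun ψ => ‖ψ‖ ^ 2) (by fun_prop)
      (fun _ => by positivity) (U := U) ?_
    refine pow_ne_zero 2 (norm_ne_zero_iff.mpr fun h => hU ?_)
    rw [h, inner_zero_left]
  have h2 : 0 < N.meanOverlapPowFour μ ref Φ φ :=
    N.integral_randomState_pos (f := fun ψ => ‖(inner ℂ ψ φ : ℂ)‖ ^ 4) (by fun_prop)
      (fun _ => by positivity) (pow_ne_zero 4 (norm_ne_zero_iff.mpr hU))
  have h3 : (0 : ℝ) < N.physDim := by exact_mod_cast N.physDim_pos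
  rw [effDim, invEffDim]
  positivity

end TensorNetwork
end

theorem mainTheorem10 {V E X : Type*} [Fintype V] [DecidableEq V] [Fintype E] [DecidableEq E]
    [Fintype X] [DecidableEq X] (N : TensorNetwork V E X)
    (Ω : (k : V) → Matrix (N.Leg k) (N.Leg k) ℂ) (hΩ : ∀ k, IsUnitarySymplecticForm (Ω k))
    (ref : (k : V) → EuclideanSpace ℂ (N.Leg k)) (href : ∀ k, ‖ref k‖ = 1)
    (Φ : N.Bulk) (hΦ : ‖Φ‖ = 1) (φ : N.Boundary) (hφ : ‖φ‖ = 1) :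
    (∀ (k : V) (t : ℕ),
      momentOperator (haarSymplectic (Ω k)) (ref k) t =
        momentOperator (haarUnitary (N.Leg k)) (ref k) t) ∧
    0 < N.effDim (fun k => haarUnitary (N.Leg k)) ref Φ φ ∧
    N.effDim (fun k => haarSymplectic (Ω k)) ref Φ φ =
      N.effDim (fun k => haarUnitary (N.Leg k)) ref Φ φ := by
  have h (k : V) := (hΩ k).map_applyUnitary_haarSymplectic (href k)
  exact ⟨fun k t => momentOperator_congr (h k) t, N.effDim_pos hΩ href
    (norm_ne_zero_iff.mp (hΦ ▸ one_ne_zero)) (norm_ne_zero_iff.mp (hφ ▸ one_ne_zero)),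
    N.effDim_congr Φ φ ref h⟩
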